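/- Consider an $M$-antenna base station ($M\ge 1$) serving $M$ single-antenna users under i.i.d. Rayleigh fading: the channel row vectors $\mathbf h_1,\dots,\mathbf h_M\in\mathbb C^{1\times M}$ have independent $\mathcal{CN}(0,1)$ entries, and uplink and downlink channels coincide (reciprocity). Let $P>0$ be the downlink power, $f\in(0,1]$ and $\alpha>0$. The base station has received $\beta\ge 1$ (integer) uplink training pilots from each user: user $k$'s $t$-th pilot is a known symbol $x_{k,t}\in\mathbb C$ with $|x_{k,t}|^2=fP$, received by the base station as $\mathbf h_k x_{k,t}+\mathbf z_{k,t}$, where the noise vectors $\mathbf z_{k,t}$ have independent $\mathcal{CN}(0,1)$ entries, independent of the channels. Let $\hat{\mathbf H}$ be the MMSE estimate (conditional mean) of the channel matrix given these $\beta M$ received training vectors, and let $\hat{\mathbf v}_1,\dots,\hat{\mathbf v}_M$ be the corresponding zero-forcing precoding vectors (the columns of $\hat{\mathbf H}^{-1}$, scaled to unit Euclidean norm); let $\mathbf v_1,\dots,\mathbf v_M$ be the zero-forcing vectors obtained in the same way from the true channel matrix. Each beam carries power $P/M$, the receiver noise has unit variance, interference is treated as noise, and the inter-node interference (INI) has power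 $\alpha fP$. The ergodic rate of user $k$ with perfect channel knowledge at the base station and no INI, and its ergodic rate with precoding based on $\hat{\mathbf H}$ under inter-beam interference and INI, are $$R^{\mathrm{ZF}}=\mathbb E\Big[\log\Big(1+\tfrac PM|\mathbf h_k\mathbf v_k|^2\Big)\Big],\qquad R_{\mathrm{INI}}(\beta M)=\mathbb E\left[\log\left(1+\frac{\frac PM|\mathbf h_k\hat{\mathbf v}_k|^2}{1+\frac PM\sum_{j\ne k}|\mathbf h_k\hat{\mathbf v}_j|^2+\alpha fP}\right)\right].$$ Then both expectations are finite and, for every user $k$ and every integer $\beta\ge1$, $$R_{\mathrm{INI}}(\beta M)\ \ge\ R^{\mathrm{ZF}}-\log\left(\frac{1+\frac PM\frac{M-1}{1+\beta fP}+\alpha fP}{1+\frac{\alpha fP}{1+P/M}}\right).$$ Moreover, as $\beta\to\infty$ the upper bound on the rate loss, i.e. the logarithmic term above, converges to $$\widetilde{\Delta R}_{\mathrm{INI}}=\log\left(\frac{1+\alpha fP}{1+\frac{\alpha fP}{1+P/M}}\right).$$ -/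

import Mathlib

open MeasureTheory ProbabilityTheory Filter Topology

noncomputable section

/-- The circularly symmetric complex Gaussian law with mean zero and unit variance: real and
imaginary parts are independent centred real Gaussians of variance one half. -/
def stdComplexGaussian : Measure ℂ :=
  ((gaussianReal 0 (1 / 2)).prod (gaussianReal 0 (1 / 2))).map
    (fun p : ℝ × ℝ => (⟨p.1, p.2⟩ : ℂ))

/-- Rayleigh fading and receiver noise. `h k m` is the channel coefficient between antenna `m` of
the base station and user `k` (uplink and downlink agree by reciprocity), and `z k t m` is the
noise at antenna `m` while user `k` sends its pilot number `t`.  All of them are independent,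
with zero mean and unit variance circularly symmetric complex Gaussian laws. -/
structure IsRayleighTraining {Ω : Type*} [MeasurableSpace Ω] (μ : Measure Ω) {M : ℕ}
    (h : Fin M → Fin M → Ω → ℂ) (z : Fin M → ℕ → Fin M → Ω → ℂ) : Prop where
  measurable_channel : ∀ k m, Measurable (h k m)
  measurable_noise : ∀ k t m, Measurable (z k t m)
  law_channel : ∀ k m, μ.map (h k m) = stdComplexGaussian
  law_noise : ∀ k t m, μ.map (z k t m) = stdComplexGaussian
  indep : iIndepFun
    (Sum.elim (fun i : Fin M × Fin M => h i.1 i.2)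
      (fun i : Fin M × ℕ × Fin M => z i.1 i.2.1 i.2.2)) μ

/-- The channel matrix; row `k` is the channel of user `k`. -/
def channelMatrix {Ω : Type*} {M : ℕ} (h : Fin M → Fin M → Ω → ℂ) (ω : Ω) :
    Matrix (Fin M) (Fin M) ℂ :=
  Matrix.of fun k m => h k m ω

/-- The signal received at antenna `m` when user `k` sends its pilot symbol `xUP k t`. -/
def receivedPilot {Ω : Type*} {M : ℕ} (h : Fin M → Fin M → Ω → ℂ)
    (z : Fin M → ℕ → Fin M → Ω → ℂ) (xUP : Fin M → ℕ → ℂ)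
    (k : Fin M) (t : ℕ) (m : Fin M) (ω : Ω) : ℂ :=
  h k m ω * xUP k t + z k t m ω

/-- The information of the base station after `β` pilots from each user: the σ-algebra generated
by the `β * M` received training vectors. -/
abbrev trainingSigma {Ω : Type*} {M : ℕ} (h : Fin M → Fin M → Ω → ℂ)
    (z : Fin M → ℕ → Fin M → Ω → ℂ) (xUP : Fin M → ℕ → ℂ) (β : ℕ) : MeasurableSpace Ω :=
  MeasurableSpace.comap
    (fun (ω : Ω) (k : Fin M) (t : Fin β) (m : Fin M) => receivedPilot h z xUP k t m ω)
    inferInstance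

/-- The MMSE estimate of the channel matrix from `β` pilots of each user, that is, the
conditional mean of the channel given everything received during training. -/
def mmseEstimate {Ω : Type*} [MeasurableSpace Ω] (μ : Measure Ω) {M : ℕ}
    (h : Fin M → Fin M → Ω → ℂ) (z : Fin M → ℕ → Fin M → Ω → ℂ) (xUP : Fin M → ℕ → ℂ)
    (β : ℕ) (ω : Ω) : Matrix (Fin M) (Fin M) ℂ :=
  Matrix.of fun k m => (μ[h k m | trainingSigma h z xUP β]) ω

/-- The zero-forcing precoding vector of user `k` for the channel matrix `G`: column `k` of the
inverse of `G`, scaled to Euclidean norm one. -/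
def zfVector {M : ℕ} (G : Matrix (Fin M) (Fin M) ℂ) (k : Fin M) : Fin M → ℂ :=
  fun m => G⁻¹ m k / ((Real.sqrt (∑ l, ‖G⁻¹ l k‖ ^ 2) : ℝ) : ℂ)

/-- Power received by user `k` on the beam of user `j`, when the true channel matrix is `H`, the
precoder is zero-forcing for `G`, and the power `P` is split equally among the `M` beams. -/
def beamPower {M : ℕ} (P : ℝ) (H G : Matrix (Fin M) (Fin M) ℂ) (k j : Fin M) : ℝ :=
  P / M * ‖∑ m, H k m * zfVector G j m‖ ^ 2

/-- Inter-beam interference power at user `k`. -/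
def ibiPower {M : ℕ} (P : ℝ) (H G : Matrix (Fin M) (Fin M) ℂ) (k : Fin M) : ℝ :=
  ∑ j ∈ Finset.univ.erase k, beamPower P H G k j

/-- Rate (in nats) of user `k` for given channel and precoder, with Gaussian codebooks,
unit-variance noise and additional interference of power `I`; all interference is treated
as noise. -/
def instantRate {M : ℕ} (P I : ℝ) (H G : Matrix (Fin M) (Fin M) ℂ) (k : Fin M) : ℝ :=
  Real.log (1 + beamPower P H G k k / (1 + ibiPower P H G k + I))

/-- Ergodic zero-forcing rate of user `k` with perfect channel knowledge at the base station and
no inter-node interference. -/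
def rateZF {Ω : Type*} [MeasurableSpace Ω] (μ : Measure Ω) {M : ℕ}
    (h : Fin M → Fin M → Ω → ℂ) (P : ℝ) (k : Fin M) : ℝ :=
  ∫ ω, instantRate P 0 (channelMatrix h ω) (channelMatrix h ω) k ∂μ

/-- Ergodic rate of user `k` when the precoder is computed from the MMSE estimate based on `β`
pilots of each user, under inter-beam interference and inter-node interference of power
`α * f * P`. -/
def rateINI {Ω : Type*} [MeasurableSpace Ω] (μ : Measure Ω) {M : ℕ}
    (h : Fin M → Fin M → Ω → ℂ) (z : Fin M → ℕ → Fin M → Ω → ℂ) (xUP : Fin M → ℕ → ℂ)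
    (P f α : ℝ) (β : ℕ) (k : Fin M) : ℝ :=
  ∫ ω, instantRate P (α * f * P) (channelMatrix h ω) (mmseEstimate μ h z xUP β ω) k ∂μ

end

/-! The channel and noise coefficients are i.i.d. Gaussian, so their linear combinations form a
Gaussian family indexed by a Hermitian space, in which orthogonality is independence
(`IsComplexIsonormal.indepFun`). The MMSE estimate is therefore a linear projection
(`mmseEstimate_ae_eq`), and the error is independent of it, with entries of variance 1/(1+βfP).

Up to a phase, the beam of user k depends only on the estimated rows of the other users. It is thus
independent of the true row h_k, and the own-beam gain has the same law as under perfect knowledge.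
On the beam of user j ≠ k the estimated row of user k is nulled, so only the error leaks, with mean
gain 1/(1+βfP) (`exists_beamPower_mmseEstimate_ae_eq`).

Write s = P/M, c = αfP, S for the signal and I for the interference power. Dropping I from the
numerator, log(1+S/(1+I+c)) ≥ log(1+S) + log(1+c/(1+S)) - log(1+I+c). Since S ↦ log(1+c/(1+S)) is
convex and log is concave, Jensen at E S = s and at E I gives the bound. `log_one_add_div_ge` states
Jensen as pointwise tangent lines, so only the means of S and I and the law of S matter, not their
joint law. Finiteness comes from 0 ≤ log(1+x) ≤ x. -/

/-! ### The standard complex Gaussian law. -/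

instance isProbabilityMeasure_stdComplexGaussian : IsProbabilityMeasure stdComplexGaussian := by
  unfold stdComplexGaussian
  exact Measure.isProbabilityMeasure_map
    (Complex.measurableEquivRealProd.symm.measurable.aemeasurable)

theorem measurable_complex_mk : Measurable (fun p : ℝ × ℝ => (⟨p.1, p.2⟩ : ℂ)) :=
  Complex.measurableEquivRealProd.symm.measurable

/-- Each real component has variance 1/2, whence the factor 1/4. The pairing re (w * x), rather than
the inner product, matches complex-linear combinations of variables. -/
theorem integral_cexp_re_mul_stdComplexGaussian (w : ℂ) :
    ∫ x, Complex.exp (((w * x).re : ℝ) * Complex.I) ∂stdComplexGaussian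
      = Complex.exp ((-(‖w‖ ^ 2 / 4) : ℝ)) := by
  rw [stdComplexGaussian, integral_map measurable_complex_mk.aemeasurable
    (by fun_prop)]
  have h1 : ∀ p : ℝ × ℝ, Complex.exp (((w * (⟨p.1, p.2⟩ : ℂ)).re : ℝ) * Complex.I)
      = Complex.exp ((w.re : ℂ) * p.1 * Complex.I) *
        Complex.exp (((-w.im : ℝ) : ℂ) * p.2 * Complex.I) := by
    intro p
    rw [← Complex.exp_add, Complex.mul_re]
    congr 1
    push_cast
    ring
  simp_rw [h1]
  rw [integral_prod_mul (fun x : ℝ => Complex.exp ((w.re : ℂ) * x * Complex.I))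
    (fun x : ℝ => Complex.exp (((-w.im : ℝ) : ℂ) * x * Complex.I)),
    ← charFun_apply_real, ← charFun_apply_real, charFun_gaussianReal, charFun_gaussianReal,
    ← Complex.exp_add]
  congr 1
  rw [← Complex.normSq_eq_norm_sq, Complex.normSq_apply]
  push_cast
  ring

theorem integrable_norm_sq_stdComplexGaussian :
    Integrable (fun x : ℂ => ‖x‖ ^ 2) stdComplexGaussian := by
  have h2 : Integrable (fun x : ℝ => x ^ 2) (gaussianReal 0 (1 / 2)) :=
    (memLp_id_gaussianReal 2).integrable_sq
  rw [stdComplexGaussian, integrable_map_measure (by fun_prop) measurable_complex_mk.aemeasurable]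
  refine ((h2.comp_fst (gaussianReal 0 (1 / 2))).add
    (h2.comp_snd (gaussianReal 0 (1 / 2)))).congr (ae_of_all _ fun p => ?_)
  simp only [Pi.add_apply, Function.comp_apply]
  rw [← Complex.normSq_eq_norm_sq, Complex.normSq_apply, pow_two, pow_two]

theorem integral_norm_sq_stdComplexGaussian :
    ∫ x, ‖x‖ ^ 2 ∂stdComplexGaussian = 1 := by
  have h2 : Integrable (fun x : ℝ => x ^ 2) (gaussianReal 0 (1 / 2)) :=
    (memLp_id_gaussianReal 2).integrable_sq
  have h3 : ∫ x : ℝ, x ^ 2 ∂(gaussianReal 0 (1 / 2)) = 1 / 2 := by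
    have h := variance_fun_id_gaussianReal (μ := 0) (v := 1 / 2)
    rw [variance_eq_integral measurable_id'.aemeasurable] at h
    simpa using h
  rw [stdComplexGaussian, integral_map measurable_complex_mk.aemeasurable (by fun_prop)]
  have h4 : ∀ p : ℝ × ℝ, ‖(⟨p.1, p.2⟩ : ℂ)‖ ^ 2 = p.1 ^ 2 + p.2 ^ 2 := fun p => by
    rw [← Complex.normSq_eq_norm_sq, Complex.normSq_apply, pow_two, pow_two]
  simp_rw [h4]
  rw [integral_add (h2.comp_fst _) (h2.comp_snd _), integral_fun_fst (fun x : ℝ => x ^ 2),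
    integral_fun_snd (fun x : ℝ => x ^ 2), h3]
  norm_num

theorem stdComplexGaussian_singleton (c : ℂ) : stdComplexGaussian {c} = 0 := by
  have : NullSingletonClass (gaussianReal 0 (1 / 2)) := nullSingletonClass_gaussianReal (by norm_num)
  rw [stdComplexGaussian, Measure.map_apply measurable_complex_mk (measurableSet_singleton c)]
  refine measure_mono_null (t := {c.re} ×ˢ Set.univ) ?_ ?_
  · rintro p hp
    simp only [Set.mem_preimage, Set.mem_singleton_iff] at hp
    simp [← hp]
  · rw [Measure.prod_prod, measure_singleton, zero_mul]

/-- A finite measure on `ℂ` is determined by its characteristic function, here written with the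
real pairing `(w, x) ↦ re (w * x)`. -/
theorem eq_stdComplexGaussian_of_integral_cexp {ν : Measure ℂ} [IsFiniteMeasure ν]
    (hν : ∀ w : ℂ, ∫ x, Complex.exp (((w * x).re : ℝ) * Complex.I) ∂ν
      = Complex.exp ((-(‖w‖ ^ 2 / 4) : ℝ))) : ν = stdComplexGaussian := by
  refine Measure.ext_of_charFun (funext fun t => ?_)
  have key : ∀ x : ℂ, inner ℝ x t = (starRingEnd ℂ t * x).re := fun x => by
    rw [Complex.inner, Complex.mul_re, Complex.mul_re]; simp
  simp only [charFun_apply, key]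
  rw [hν, integral_cexp_re_mul_stdComplexGaussian]

/-! ### Complex Gaussian families: orthogonality and independence. -/

/-- A linear family of complex random variables with the characteristic functions of circularly
symmetric Gaussian variables of variance `‖a‖ ^ 2`. -/
structure IsComplexIsonormal {Ω : Type*} [MeasurableSpace Ω] (μ : Measure Ω)
    {E : Type*} [NormedAddCommGroup E] [InnerProductSpace ℂ E]
    (ξ : E →ₗ[ℂ] (Ω → ℂ)) : Prop where
  measurable : ∀ a, Measurable (ξ a)
  integral_cexp : ∀ a, ∫ ω, Complex.exp (((ξ a ω).re : ℝ) * Complex.I) ∂μ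
    = Complex.exp ((-(‖a‖ ^ 2 / 4) : ℝ))

/-- The linear combinations of a finite family of random variables. -/
noncomputable def linearCombinations {Ω J : Type*} [Fintype J] (W : J → Ω → ℂ) :
    EuclideanSpace ℂ J →ₗ[ℂ] (Ω → ℂ) where
  toFun a ω := ∑ j, a j * W j ω
  map_add' a b := by ext ω; simp [add_mul, Finset.sum_add_distrib]
  map_smul' c a := by ext ω; simp [Finset.mul_sum, mul_assoc]

theorem linearCombinations_apply {Ω J : Type*} [Fintype J] (W : J → Ω → ℂ)
    (a : EuclideanSpace ℂ J) (ω : Ω) : linearCombinations W a ω = ∑ j, a j * W j ω := rfl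

theorem linearCombinations_single {Ω J : Type*} [Fintype J] [DecidableEq J] (W : J → Ω → ℂ)
    (j : J) : linearCombinations W (EuclideanSpace.single j 1) = W j := by
  ext ω
  simp [linearCombinations_apply]

/-- Independence factorises the characteristic function, and the exponents add up to the squared
norm of the coefficient vector. -/
theorem isComplexIsonormal_linearCombinations {Ω J : Type*} [MeasurableSpace Ω] {μ : Measure Ω}
    [Fintype J] {W : J → Ω → ℂ} (hW : ∀ j, Measurable (W j))
    (hlaw : ∀ j, μ.map (W j) = stdComplexGaussian) (hind : iIndepFun W μ) :
    IsComplexIsonormal μ (linearCombinations W) where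
  measurable a := by
    change Measurable fun ω => ∑ j, a j * W j ω
    fun_prop
  integral_cexp a := by
    have h1 : ∀ ω, Complex.exp (((linearCombinations W a ω).re : ℝ) * Complex.I)
        = ∏ j, Complex.exp (((a j * W j ω).re : ℝ) * Complex.I) := fun ω => by
      rw [← Complex.exp_sum, ← Finset.sum_mul, linearCombinations_apply, Complex.re_sum]
      push_cast
      rfl
    simp_rw [h1]
    have h2 : iIndepFun (fun j ω => Complex.exp (((a j * W j ω).re : ℝ) * Complex.I)) μ :=
      hind.comp (fun j x => Complex.exp (((a j * x).re : ℝ) * Complex.I)) (fun j => by fun_prop)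
    rw [h2.integral_fun_prod_eq_prod_integral
      (fun j => by have := hW j; fun_prop)]
    have h3 : ∀ j, ∫ ω, Complex.exp (((a j * W j ω).re : ℝ) * Complex.I) ∂μ
        = Complex.exp ((-(‖a j‖ ^ 2 / 4) : ℝ)) := fun j => by
      rw [← integral_cexp_re_mul_stdComplexGaussian, ← hlaw j,
        integral_map (hW j).aemeasurable (by fun_prop)]
    simp_rw [h3]
    rw [← Complex.exp_sum, EuclideanSpace.norm_sq_eq]
    push_cast
    rw [Finset.sum_neg_distrib, Finset.sum_div]

/-- A real functional is the real part of a complex-linear one. Hence `integral_cexp` alone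
evaluates the characteristic function of any finite Gaussian vector of the family. -/
theorem exists_dual_apply_eq_re {Ω : Type*} {E : Type*} [AddCommGroup E] [Module ℂ E]
    (ξ : E →ₗ[ℂ] (Ω → ℂ)) {P : Type*} [Fintype P] (a : P → E)
    (L : StrongDual ℝ (P → ℂ)) : ∃ s : P → ℂ,
      ∀ ω, L (fun p => ξ (a p) ω) = (ξ (∑ p, s p • a p) ω).re := by
  classical
  refine ⟨fun p => (L.extendRCLike : StrongDual ℂ (P → ℂ)) (Pi.single p 1), fun ω => ?_⟩
  have h := StrongDual.re_extendRCLike_apply (𝕜 := ℂ) L (fun p => ξ (a p) ω)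
  rw [← h]
  have h2 : (fun p => ξ (a p) ω) = ∑ p, (ξ (a p) ω) • (Pi.single p 1 : P → ℂ) := by
    ext q; simp [Pi.single_apply]
  rw [h2]
  simp only [map_sum, map_smul, Finset.sum_apply, Pi.smul_apply, smul_eq_mul, RCLike.re_eq_complex_re]
  rw [Complex.re_sum]
  exact Finset.sum_congr rfl fun p _ => by rw [mul_comm]

namespace IsComplexIsonormal

variable {Ω : Type*} [MeasurableSpace Ω] {μ : Measure Ω} [IsProbabilityMeasure μ]
  {E : Type*} [NormedAddCommGroup E] [InnerProductSpace ℂ E] {ξ : E →ₗ[ℂ] (Ω → ℂ)}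

/-- Applying `integral_cexp` to `w • a` for every complex `w` recovers the whole characteristic
function, so circular symmetry comes from complex linearity. -/
theorem map_eq (hξ : IsComplexIsonormal μ ξ) {a : E} (ha : ‖a‖ = 1) :
    μ.map (ξ a) = stdComplexGaussian := by
  have := Measure.isProbabilityMeasure_map (μ := μ) (hξ.measurable a).aemeasurable
  refine eq_stdComplexGaussian_of_integral_cexp fun w => ?_
  rw [integral_map (hξ.measurable a).aemeasurable (by fun_prop)]
  have := hξ.integral_cexp (w • a)
  simpa [norm_smul, ha] using this

/-- Orthogonal families of Gaussian variables are independent. -/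
theorem indepFun (hξ : IsComplexIsonormal μ ξ) {P Q : Type*} [Fintype P] [Fintype Q]
    (a : P → E) (b : Q → E) (hab : ∀ p q, inner ℂ (a p) (b q) = 0) :
    IndepFun (fun ω p => ξ (a p) ω) (fun ω q => ξ (b q) ω) μ := by
  have mX : Measurable (fun ω p => ξ (a p) ω) := measurable_pi_lambda _ fun p => hξ.measurable _
  have mY : Measurable (fun ω q => ξ (b q) ω) := measurable_pi_lambda _ fun p => hξ.measurable _
  rw [indepFun_iff_charFunDual_prod mX.aemeasurable mY.aemeasurable]
  intro L
  obtain ⟨s, hs⟩ := exists_dual_apply_eq_re ξ a (L.comp (.inl ℝ _ _))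
  obtain ⟨t, ht⟩ := exists_dual_apply_eq_re ξ b (L.comp (.inr ℝ _ _))
  simp only [charFunDual_apply]
  rw [integral_map (mX.prodMk mY).aemeasurable (by fun_prop),
    integral_map mX.aemeasurable (by fun_prop), integral_map mY.aemeasurable (by fun_prop)]
  have hst : ∀ ω, L (fun p => ξ (a p) ω, fun q => ξ (b q) ω)
      = (ξ (∑ p, s p • a p + ∑ q, t q • b q) ω).re := fun ω => by
    rw [map_add, Pi.add_apply, Complex.add_re, ← hs, ← ht]
    simp only [ContinuousLinearMap.comp_apply, ContinuousLinearMap.inl_apply,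
      ContinuousLinearMap.inr_apply, ← map_add]
    simp
  simp_rw [hst, hs, ht]
  rw [hξ.integral_cexp, hξ.integral_cexp, hξ.integral_cexp, ← Complex.exp_add]
  -- Pythagoras splits the exponent, so the joint characteristic function is a product.
  have horth : inner ℂ (∑ p, s p • a p) (∑ q, t q • b q) = 0 := by
    simp [hab]
  have := norm_add_sq_eq_norm_sq_add_norm_sq_of_inner_eq_zero _ _ horth
  congr 1
  simp only [pow_two, this]
  push_cast
  ring

end IsComplexIsonormal

/-- A random unit vector independent of a vector with rotation invariant Gaussian projections
still gives a standard complex Gaussian projection. -/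
theorem map_sum_mul_eq_stdComplexGaussian {Ω n : Type*} [MeasurableSpace Ω] {μ : Measure Ω}
    [IsProbabilityMeasure μ] [Fintype n] {X V : Ω → n → ℂ} (hX : Measurable X)
    (hV : Measurable V) (hind : IndepFun X V μ) (hunit : ∀ᵐ ω ∂μ, ∑ m, ‖V ω m‖ ^ 2 = 1)
    (hlaw : ∀ v : n → ℂ, ∑ m, ‖v m‖ ^ 2 = 1 →
      μ.map (fun ω => ∑ m, X ω m * v m) = stdComplexGaussian) :
    μ.map (fun ω => ∑ m, X ω m * V ω m) = stdComplexGaussian := by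
  have hf : Measurable (fun p : (n → ℂ) × (n → ℂ) => ∑ m, p.1 m * p.2 m) := by fun_prop
  have := Measure.isProbabilityMeasure_map (μ := μ) hX.aemeasurable
  have := Measure.isProbabilityMeasure_map (μ := μ) hV.aemeasurable
  ext s hs
  have h1 : μ.map (fun ω => ∑ m, X ω m * V ω m)
      = ((μ.map X).prod (μ.map V)).map (fun p => ∑ m, p.1 m * p.2 m) := by
    rw [← (indepFun_iff_map_prod_eq_prod_map_map hX.aemeasurable hV.aemeasurable).1 hind,
      Measure.map_map hf (hX.prodMk hV)]
    rfl
  rw [h1, Measure.map_apply hf hs, Measure.prod_apply_symm (hf hs)]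
  have h2 : ∀ᵐ v ∂(μ.map V), (μ.map X)
      ((fun x => (x, v)) ⁻¹' ((fun p : (n → ℂ) × (n → ℂ) => ∑ m, p.1 m * p.2 m) ⁻¹' s))
      = stdComplexGaussian s := by
    have h3 : ∀ᵐ v ∂(μ.map V), ∑ m, ‖v m‖ ^ 2 = 1 :=
      (ae_map_iff hV.aemeasurable (measurableSet_eq_fun (by fun_prop) (by fun_prop))).2 hunit
    filter_upwards [h3] with v hv
    rw [← hlaw v hv, Measure.map_apply (by fun_prop) hs,
      Measure.map_apply hX (measurable_prodMk_right (hf hs))]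
    rfl
  rw [lintegral_congr_ae h2]
  simp

/-! ### Almost sure invertibility of Gaussian matrices. -/

/-- An affine function of a diffuse random variable, with independent coefficients, does not
vanish. -/
theorem ae_mul_add_ne_zero {Ω β : Type*} [MeasurableSpace Ω] [MeasurableSpace β] {μ : Measure Ω}
    [IsProbabilityMeasure μ] {X : Ω → ℂ} {Y : Ω → β} (hX : Measurable X) (hY : Measurable Y)
    (hind : IndepFun X Y μ) (hdiff : ∀ c, μ {ω | X ω = c} = 0) {d r : β → ℂ}
    (hd : Measurable d) (hr : Measurable r) (hne : ∀ᵐ ω ∂μ, d (Y ω) ≠ 0) :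
    ∀ᵐ ω ∂μ, X ω * d (Y ω) + r (Y ω) ≠ 0 := by
  have hf : Measurable (fun p : ℂ × β => p.1 * d p.2 + r p.2) := by fun_prop
  have := Measure.isProbabilityMeasure_map (μ := μ) hX.aemeasurable
  have := Measure.isProbabilityMeasure_map (μ := μ) hY.aemeasurable
  have hs : MeasurableSet {p : ℂ × β | p.1 * d p.2 + r p.2 = 0} :=
    hf (measurableSet_singleton 0)
  have h1 : (μ.map (fun ω => (X ω, Y ω))) {p : ℂ × β | p.1 * d p.2 + r p.2 = 0} = 0 := by
    rw [(indepFun_iff_map_prod_eq_prod_map_map hX.aemeasurable hY.aemeasurable).1 hind,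
      Measure.prod_apply_symm hs]
    have h3 : ∀ᵐ y ∂(μ.map Y), d y ≠ 0 :=
      (ae_map_iff hY.aemeasurable (hd (measurableSet_singleton 0).compl)).2 hne
    rw [lintegral_eq_zero_iff (measurable_measure_prodMk_right hs)]
    filter_upwards [h3] with y hy
    rw [Measure.map_apply hX (measurable_prodMk_right hs)]
    -- For fixed coefficients the only root is `-r y / d y`, a null event for `X`.
    refine measure_mono_null (fun ω hω => ?_) (hdiff (-r y / d y))
    simp only [Set.mem_preimage, Set.mem_ofPred_eq] at hω ⊢
    rw [eq_div_iff hy]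
    linear_combination hω
  rw [Measure.map_apply (hX.prodMk hY) hs] at h1
  rw [ae_iff]
  simpa using h1

/-- By expansion along the first row, the determinant is affine in its corner entry; `B` is `A` with
that entry erased. -/
theorem det_eq_corner_mul_add {n : ℕ} (A B : Matrix (Fin (n + 1)) (Fin (n + 1)) ℂ)
    (h0 : B 0 0 = 0) (h : ∀ i j, (i, j) ≠ (0, 0) → B i j = A i j) :
    A.det = A 0 0 * (B.submatrix Fin.succ Fin.succ).det + B.det := by
  have hsub : ∀ j : Fin (n + 1), B.submatrix Fin.succ j.succAbove
      = A.submatrix Fin.succ j.succAbove := fun j => by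
    ext a b
    exact h _ _ (by simp [Fin.succ_ne_zero])
  have hsub0 := hsub 0
  rw [Fin.succAbove_zero] at hsub0
  have hrow : ∀ j : Fin n, B 0 j.succ = A 0 j.succ := fun j =>
    h _ _ (by simp [Fin.succ_ne_zero])
  rw [Matrix.det_succ_row_zero A, Matrix.det_succ_row_zero B, Fin.sum_univ_succ,
    Fin.sum_univ_succ, h0]
  simp only [hsub, hsub0, hrow, Fin.succAbove_zero]
  simp

namespace IsComplexIsonormal

variable {Ω : Type*} [MeasurableSpace Ω] {μ : Measure Ω} [IsProbabilityMeasure μ]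
  {E : Type*} [NormedAddCommGroup E] [InnerProductSpace ℂ E] {ξ : E →ₗ[ℂ] (Ω → ℂ)}

theorem measure_eq_const (hξ : IsComplexIsonormal μ ξ) {a : E} (ha : a ≠ 0) (c : ℂ) :
    μ {ω | ξ a ω = c} = 0 := by
  have hn : (‖a‖ : ℂ) ≠ 0 := by simpa using ha
  have h1 : ‖(‖a‖ : ℂ)⁻¹ • a‖ = 1 := by
    rw [norm_smul, norm_inv, Complex.norm_real, norm_norm]
    exact inv_mul_cancel₀ (norm_ne_zero_iff.2 ha)
  have h2 := stdComplexGaussian_singleton ((‖a‖ : ℂ)⁻¹ * c)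
  rw [← hξ.map_eq h1, Measure.map_apply (hξ.measurable _) (measurableSet_singleton _)] at h2
  refine measure_mono_null (fun ω hω => ?_) h2
  simp only [Set.mem_ofPred_eq] at hω
  simp [hω]

/-- Induction on the size: the corner entry is diffuse and independent of all others, and the
determinant is affine in it, with slope a smaller minor that is almost surely nonzero. -/
theorem ae_det_ne_zero (hξ : IsComplexIsonormal μ ξ) {n : ℕ} (g : Fin n → Fin n → E)
    (hne : ∀ i j, g i j ≠ 0)
    (horth : ∀ i j i' j', (i, j) ≠ (i', j') → inner ℂ (g i j) (g i' j') = 0) :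
    ∀ᵐ ω ∂μ, (Matrix.of fun i j => ξ (g i j) ω).det ≠ 0 := by
  induction n with
  | zero => simp
  | succ n ih =>
    have hsub := ih (fun i j => g i.succ j.succ) (fun i j => hne _ _)
      (fun i j i' j' h => horth _ _ _ _ (by simpa using h))
    let Q := {q : Fin (n + 1) × Fin (n + 1) // q ≠ (0, 0)}
    let B : (Q → ℂ) → Matrix (Fin (n + 1)) (Fin (n + 1)) ℂ := fun y =>
      Matrix.of fun i j => if h : (i, j) ≠ (0, 0) then y ⟨(i, j), h⟩ else 0
    have hB : Continuous B := by
      refine continuous_matrix fun i j => ?_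
      simp only [B, Matrix.of_apply]
      split_ifs <;> fun_prop
    have hindep : IndepFun (ξ (g 0 0)) (fun ω (q : Q) => ξ (g q.1.1 q.1.2) ω) μ :=
      (hξ.indepFun (fun _ : Unit => g 0 0) (fun q : Q => g q.1.1 q.1.2)
        (fun _ q => horth _ _ _ _ q.2.symm)).comp (measurable_pi_apply ()) measurable_id
    have hmeas : Measurable (fun ω (q : Q) => ξ (g q.1.1 q.1.2) ω) :=
      measurable_pi_lambda _ fun q => hξ.measurable _
    have key := ae_mul_add_ne_zero (hξ.measurable (g 0 0)) hmeas hindep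
      (hξ.measure_eq_const (hne 0 0))
      (d := fun y => ((B y).submatrix Fin.succ Fin.succ).det) (r := fun y => (B y).det)
      (hB.matrix_submatrix _ _).matrix_det.measurable hB.matrix_det.measurable ?_
    · filter_upwards [key] with ω hω
      rw [det_eq_corner_mul_add _ (B fun q => ξ (g q.1.1 q.1.2) ω)]
      · simpa using hω
      · simp [B]
      · intro i j hij
        exact dif_pos hij
    · filter_upwards [hsub] with ω hω
      convert! hω using 2

end IsComplexIsonormal

/-! ### Zero-forcing vectors and cofactors. -/

theorem measurable_div_sqrt_sum_norm_sq {n β : Type*} [Fintype n] [MeasurableSpace β]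
    {v : β → n → ℂ} (hv : ∀ m, Measurable fun b => v b m) :
    Measurable fun b m => v b m / ((Real.sqrt (∑ l, ‖v b l‖ ^ 2) : ℝ) : ℂ) :=
  measurable_pi_lambda _ fun m => (hv m).div (Complex.measurable_ofReal.comp
    (Real.continuous_sqrt.measurable.comp
      (Finset.measurable_fun_sum _ fun l _ => (hv l).norm.pow_const 2)))

/-- Column `k` of the adjugate, scaled to Euclidean norm one. -/
noncomputable def unitCofactor {M : ℕ} (G : Matrix (Fin M) (Fin M) ℂ) (k : Fin M) : Fin M → ℂ :=
  fun m => G.adjugate m k / ((Real.sqrt (∑ l, ‖G.adjugate l k‖ ^ 2) : ℝ) : ℂ)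

theorem measurable_unitCofactor {M : ℕ} {β : Type*} [MeasurableSpace β]
    {A : β → Matrix (Fin M) (Fin M) ℂ} (hA : ∀ i j, Measurable fun b => A b i j) (k : Fin M) :
    Measurable fun b => unitCofactor (A b) k := by
  have hadj : ∀ m, Measurable fun b => (A b).adjugate m k := fun m => by
    have hc : Continuous fun G : Fin M → Fin M → ℂ => (Matrix.of G).adjugate m k :=
      (Continuous.matrix_adjugate (continuous_matrix fun i j => by
        simp only [Matrix.of_apply]; fun_prop)).matrix_elem m k
    exact hc.measurable.comp (measurable_pi_lambda _ fun i => measurable_pi_lambda _ fun j => hA i j)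
  exact measurable_div_sqrt_sum_norm_sq hadj

theorem measurable_zfVector {M : ℕ} {β : Type*} [MeasurableSpace β]
    {A : β → Matrix (Fin M) (Fin M) ℂ} (hA : ∀ i j, Measurable fun b => A b i j) (k : Fin M) :
    Measurable fun b => zfVector (A b) k := by
  have hpi : Measurable fun b i j => A b i j :=
    measurable_pi_lambda _ fun i => measurable_pi_lambda _ fun j => hA i j
  have hof : Continuous fun G : Fin M → Fin M → ℂ => Matrix.of G :=
    continuous_matrix fun i j => by simp only [Matrix.of_apply]; fun_prop
  have hadj : ∀ m, Measurable fun b => (A b).adjugate m k := fun m =>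
    (hof.matrix_adjugate.matrix_elem m k).measurable.comp hpi
  have hdet : Measurable fun b => (A b).det := hof.matrix_det.measurable.comp hpi
  have hinv : ∀ m, Measurable fun b => (A b)⁻¹ m k := fun m => by
    simp only [Matrix.inv_def, Matrix.smul_apply, Ring.inverse_eq_inv', smul_eq_mul]
    exact hdet.inv.mul (hadj m)
  exact measurable_div_sqrt_sum_norm_sq hinv

/-- The cofactors in column `k` of the adjugate delete row `k`, so they do not see it. This gives
the independence of a beam from its own user's row. -/
theorem unitCofactor_congr {M : ℕ} {G G' : Matrix (Fin M) (Fin M) ℂ} {k : Fin M}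
    (h : ∀ i, i ≠ k → G i = G' i) : unitCofactor G k = unitCofactor G' k := by
  have hadj : ∀ m, G.adjugate m k = G'.adjugate m k := fun m => by
    rw [Matrix.adjugate_apply, Matrix.adjugate_apply]
    congr 1
    ext i j
    by_cases hi : i = k
    · subst hi; simp
    · simp [Matrix.updateRow_ne hi, h i hi]
  unfold unitCofactor
  simp only [hadj]

theorem sum_norm_sq_div_sqrt {n : Type*} [Fintype n] {v : n → ℂ} (hv : v ≠ 0) :
    ∑ m, ‖v m / ((Real.sqrt (∑ l, ‖v l‖ ^ 2) : ℝ) : ℂ)‖ ^ 2 = 1 := by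
  obtain ⟨i, hi⟩ := Function.ne_iff.1 hv
  have hpos : 0 < ∑ l, ‖v l‖ ^ 2 :=
    Finset.sum_pos' (fun l _ => by positivity)
      ⟨i, Finset.mem_univ i, by have := norm_pos_iff.2 hi; positivity⟩
  simp only [norm_div, Complex.norm_real, Real.norm_eq_abs, div_pow, sq_abs,
    Real.sq_sqrt hpos.le]
  rw [← Finset.sum_div, div_self hpos.ne']

theorem sum_norm_sq_unitCofactor {M : ℕ} {G : Matrix (Fin M) (Fin M) ℂ} (hG : G.det ≠ 0)
    (k : Fin M) : ∑ m, ‖unitCofactor G k m‖ ^ 2 = 1 := by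
  refine sum_norm_sq_div_sqrt (v := fun m => G.adjugate m k) fun h => hG ?_
  have h1 := congr_fun (congr_fun (Matrix.mul_adjugate G) k) k
  rw [Matrix.mul_apply] at h1
  simp only [funext_iff, Pi.zero_apply] at h
  simpa [h] using h1.symm

theorem sum_norm_sq_zfVector {M : ℕ} {G : Matrix (Fin M) (Fin M) ℂ} (hG : G.det ≠ 0)
    (k : Fin M) : ∑ m, ‖zfVector G k m‖ ^ 2 = 1 := by
  refine sum_norm_sq_div_sqrt (v := fun m => G⁻¹ m k) fun h => ?_
  have h1 := congr_fun (congr_fun (Matrix.mul_nonsing_inv G (isUnit_iff_ne_zero.2 hG)) k) k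
  rw [Matrix.mul_apply] at h1
  simp only [funext_iff, Pi.zero_apply] at h
  simp [h] at h1

theorem sum_mul_zfVector_of_ne {M : ℕ} {G : Matrix (Fin M) (Fin M) ℂ} (hG : G.det ≠ 0)
    {j k : Fin M} (hjk : j ≠ k) : ∑ m, G k m * zfVector G j m = 0 := by
  have h1 := congr_fun (congr_fun (Matrix.mul_nonsing_inv G (isUnit_iff_ne_zero.2 hG)) k) j
  rw [Matrix.mul_apply, Matrix.one_apply_ne hjk.symm] at h1
  simp only [zfVector, ← mul_div_assoc, ← Finset.sum_div, h1, zero_div]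

/-- The inverse is the adjugate divided by the determinant; after scaling, the two vectors differ by
the phase of the determinant, which the modulus removes. -/
theorem norm_sum_mul_zfVector {M : ℕ} {G : Matrix (Fin M) (Fin M) ℂ} (hG : G.det ≠ 0)
    (x : Fin M → ℂ) (k : Fin M) :
    ‖∑ m, x m * zfVector G k m‖ = ‖∑ m, x m * unitCofactor G k m‖ := by
  have hinv : ∀ m, G⁻¹ m k = G.det⁻¹ * G.adjugate m k := fun m => by
    simp [Matrix.inv_def, Ring.inverse_eq_inv']
  have hd : 0 < ‖G.det‖ := norm_pos_iff.2 hG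
  have hsq : Real.sqrt (∑ l, ‖G⁻¹ l k‖ ^ 2)
      = ‖G.det‖⁻¹ * Real.sqrt (∑ l, ‖G.adjugate l k‖ ^ 2) := by
    simp only [hinv, norm_mul, mul_pow, ← Finset.mul_sum]
    rw [Real.sqrt_mul (sq_nonneg _), Real.sqrt_sq (norm_nonneg _), norm_inv]
  simp only [zfVector, unitCofactor, hsq]
  simp only [hinv, mul_left_comm _ (G.det⁻¹), ← mul_div_assoc, ← Finset.sum_div,
    ← Finset.mul_sum, norm_div, norm_mul, Complex.norm_real, norm_inv, norm_norm]
  rw [mul_div_mul_left _ _ (inv_ne_zero hd.ne')]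

/-! ### Moments of the family and projections on random unit vectors. -/

namespace IsComplexIsonormal

variable {Ω : Type*} [MeasurableSpace Ω] {μ : Measure Ω} [IsProbabilityMeasure μ]
  {E : Type*} [NormedAddCommGroup E] [InnerProductSpace ℂ E] {ξ : E →ₗ[ℂ] (Ω → ℂ)}

theorem integrable (hξ : IsComplexIsonormal μ ξ) (a : E) : Integrable (ξ a) μ := by
  by_cases ha : a = 0
  · subst ha; rw [map_zero]; exact integrable_zero _ _ _
  have hn : (‖a‖ : ℂ) ≠ 0 := by simpa using ha
  have h1 : ‖(‖a‖ : ℂ)⁻¹ • a‖ = 1 := by simp [norm_smul, ha]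
  have h2 : Integrable (fun x : ℂ => x) stdComplexGaussian :=
    ((memLp_two_iff_integrable_sq_norm (by fun_prop)).2
      integrable_norm_sq_stdComplexGaussian).integrable (by norm_num)
  rw [← hξ.map_eq h1] at h2
  have h3 : Integrable (ξ ((‖a‖ : ℂ)⁻¹ • a)) μ := h2.comp_measurable (hξ.measurable _)
  rw [← smul_inv_smul₀ hn a, map_smul]
  exact h3.smul _

/-- After normalisation, `a` and `-a` give variables of the same law, so the mean equals its own
negative. -/
theorem integral_eq_zero (hξ : IsComplexIsonormal μ ξ) (a : E) : ∫ ω, ξ a ω ∂μ = 0 := by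
  by_cases ha : a = 0
  · subst ha; simp
  have hn : (‖a‖ : ℂ) ≠ 0 := by simpa using ha
  have h0 : ∀ b : E, ‖b‖ = 1 → ∫ ω, ξ b ω ∂μ = ∫ x, x ∂stdComplexGaussian := fun b hb => by
    rw [← hξ.map_eq hb, integral_map (hξ.measurable _).aemeasurable (by fun_prop)]
  have h1 : ‖(‖a‖ : ℂ)⁻¹ • a‖ = 1 := by simp [norm_smul, ha]
  have h2 := h0 _ h1
  have h3 := h0 (-((‖a‖ : ℂ)⁻¹ • a)) (by rwa [norm_neg])
  rw [← h2] at h3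
  simp only [map_neg, map_smul, Pi.neg_apply, Pi.smul_apply, integral_neg, integral_smul] at h3
  have h4 := self_eq_neg.1 h3.symm
  exact (smul_eq_zero.1 h4).resolve_left (inv_ne_zero hn)

theorem map_sum_mul_eq (hξ : IsComplexIsonormal μ ξ) {n : Type*} [Fintype n] {b : n → E}
    (hb : Orthonormal ℂ b) {v : n → ℂ} (hv : ∑ m, ‖v m‖ ^ 2 = 1) :
    μ.map (fun ω => ∑ m, ξ (b m) ω * v m) = stdComplexGaussian := by
  have h1 : ‖∑ m, v m • b m‖ = 1 := by
    have h3 : ‖∑ m, v m • b m‖ ^ 2 = 1 := by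
      rw [← inner_self_eq_norm_sq (𝕜 := ℂ), hb.inner_sum, ← hv]
      simp only [Complex.conj_mul', ← Complex.ofReal_pow, ← Complex.ofReal_sum]
      exact Complex.ofReal_re _
    exact (pow_eq_one_iff_of_nonneg (norm_nonneg _) two_ne_zero).1 h3
  rw [← hξ.map_eq h1]
  congr 1
  ext ω
  simp [mul_comm]

/-- The projection of an orthonormal Gaussian row on an independent random unit vector. -/
theorem map_sum_mul_eq_of_orthogonal (hξ : IsComplexIsonormal μ ξ) {n Q : Type*} [Fintype n]
    [Fintype Q] {b : n → E} (hb : Orthonormal ℂ b) {c : Q → E}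
    (hbc : ∀ m q, inner ℂ (b m) (c q) = 0) {F : (Q → ℂ) → n → ℂ} (hF : Measurable F)
    (hunit : ∀ᵐ ω ∂μ, ∑ m, ‖F (fun q => ξ (c q) ω) m‖ ^ 2 = 1) :
    μ.map (fun ω => ∑ m, ξ (b m) ω * F (fun q => ξ (c q) ω) m) = stdComplexGaussian :=
  map_sum_mul_eq_stdComplexGaussian (X := fun ω m => ξ (b m) ω)
    (V := fun ω => F (fun q => ξ (c q) ω))
    (measurable_pi_lambda _ fun _ => hξ.measurable _)
    (hF.comp (measurable_pi_lambda _ fun _ => hξ.measurable _))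
    ((hξ.indepFun b c hbc).comp measurable_id hF) hunit
    fun _ hv => hξ.map_sum_mul_eq hb hv

/-- The gain of a user on its own zero-forcing beam, when the row of that user is a standard
Gaussian vector independent of the other rows of the precoding matrix. -/
theorem exists_map_eq_norm_zfVector (hξ : IsComplexIsonormal μ ξ) {M : ℕ} {k : Fin M}
    {b : Fin M → E} (hb : Orthonormal ℂ b) (g : Fin M → Fin M → E)
    (hbg : ∀ m i j, i ≠ k → inner ℂ (b m) (g i j) = 0)
    (hdet : ∀ᵐ ω ∂μ, (Matrix.of fun i j => ξ (g i j) ω).det ≠ 0) :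
    ∃ Z : Ω → ℂ, Measurable Z ∧ μ.map Z = stdComplexGaussian ∧
      ∀ᵐ ω ∂μ, ‖∑ m, ξ (b m) ω * zfVector (Matrix.of fun i j => ξ (g i j) ω) k m‖ = ‖Z ω‖ := by
  let Q := {q : Fin M × Fin M // q.1 ≠ k}
  -- Row `k` is filled with zeros: `unitCofactor` ignores it, and the vector becomes a function of
  -- the other rows alone.
  let B : (Q → ℂ) → Matrix (Fin M) (Fin M) ℂ := fun y =>
    Matrix.of fun i j => if h : i ≠ k then y ⟨(i, j), h⟩ else 0
  have hB : ∀ i j, Measurable fun y => B y i j := fun i j => by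
    by_cases h : i ≠ k
    · have : (fun y => B y i j) = fun y => y ⟨(i, j), h⟩ := funext fun y => dif_pos h
      rw [this]
      exact measurable_pi_apply _
    · have : (fun y => B y i j) = fun y => 0 := funext fun y => dif_neg h
      rw [this]
      exact measurable_const
  have hF : Measurable fun y => unitCofactor (B y) k := measurable_unitCofactor hB k
  have hmeas : Measurable fun ω (q : Q) => ξ (g q.1.1 q.1.2) ω :=
    measurable_pi_lambda _ fun _ => hξ.measurable _
  have hcof : ∀ ω, unitCofactor (B fun q => ξ (g q.1.1 q.1.2) ω) k
      = unitCofactor (Matrix.of fun i j => ξ (g i j) ω) k := fun ω =>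
    unitCofactor_congr fun i hi => funext fun j => dif_pos hi
  have hunit : ∀ᵐ ω ∂μ, ∑ m, ‖unitCofactor (B fun q => ξ (g q.1.1 q.1.2) ω) k m‖ ^ 2 = 1 := by
    filter_upwards [hdet] with ω hω
    rw [hcof]
    exact sum_norm_sq_unitCofactor hω k
  have hlaw := hξ.map_sum_mul_eq_of_orthogonal hb (c := fun q : Q => g q.1.1 q.1.2)
    (fun m q => hbg m q.1.1 q.1.2 q.2) hF hunit
  refine ⟨_, Finset.measurable_fun_sum _ fun m _ =>
      (hξ.measurable (b m)).mul ((measurable_pi_apply m).comp (hF.comp hmeas)), hlaw, ?_⟩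
  filter_upwards [hdet] with ω hω
  rw [norm_sum_mul_zfVector hω, ← hcof]
  rfl

end IsComplexIsonormal

/-! ### Pilot training: orthogonality relations and the MMSE estimate. -/

/-- The channel coefficients together with the noise during the first `β` pilots. -/
def trainingVariables {Ω : Type*} {M : ℕ} (h : Fin M → Fin M → Ω → ℂ)
    (z : Fin M → ℕ → Fin M → Ω → ℂ) (β : ℕ) :
    (Fin M × Fin M) ⊕ (Fin M × Fin β × Fin M) → Ω → ℂ :=
  Sum.elim (fun i => h i.1 i.2) (fun i => z i.1 i.2.1 i.2.2)

theorem IsRayleighTraining.isComplexIsonormal {Ω : Type*} [MeasurableSpace Ω] {μ : Measure Ω}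
    {M : ℕ} {h : Fin M → Fin M → Ω → ℂ} {z : Fin M → ℕ → Fin M → Ω → ℂ}
    (hmodel : IsRayleighTraining μ h z) (β : ℕ) :
    IsComplexIsonormal μ (linearCombinations (trainingVariables h z β)) := by
  refine isComplexIsonormal_linearCombinations ?_ ?_ ?_
  · rintro (i | i)
    exacts [hmodel.measurable_channel _ _, hmodel.measurable_noise _ _ _]
  · rintro (i | i)
    exacts [hmodel.law_channel _ _, hmodel.law_noise _ _ _]
  · have hinj : Function.Injective (Sum.map id fun i : Fin M × Fin β × Fin M =>
        ((i.1, (i.2.1 : ℕ), i.2.2) : Fin M × ℕ × Fin M)) :=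
      Function.Injective.sumMap (Function.injective_id (α := Fin M × Fin M)) fun i j hij => by
        simp only [Prod.mk.injEq, Fin.val_inj] at hij
        ext1
        exacts [hij.1, Prod.ext hij.2.1 hij.2.2]
    convert! hmodel.indep.precomp hinj using 1
    ext i
    rcases i with i | i <;> rfl

/-- The coefficient space of linear combinations of the channel and the training noise. -/
abbrev TrainingSpace (M β : ℕ) : Type :=
  EuclideanSpace ℂ ((Fin M × Fin M) ⊕ (Fin M × Fin β × Fin M))

noncomputable section

variable {M β : ℕ}

def channelCoeff (β : ℕ) (k m : Fin M) : TrainingSpace M β :=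
  EuclideanSpace.single (Sum.inl (k, m)) 1

def receivedCoeff (x : Fin M → ℕ → ℂ) (k : Fin M) (t : Fin β) (m : Fin M) : TrainingSpace M β :=
  x k t • channelCoeff β k m + EuclideanSpace.single (Sum.inr (k, t, m)) 1

/-- The linear MMSE estimate for pilots of power `p`. -/
def estimateCoeff (β : ℕ) (x : Fin M → ℕ → ℂ) (p : ℝ) (k m : Fin M) : TrainingSpace M β :=
  ∑ t : Fin β, (starRingEnd ℂ (x k t) / (1 + β * p : ℝ)) • receivedCoeff x k t m

def errorCoeff (β : ℕ) (x : Fin M → ℕ → ℂ) (p : ℝ) (k m : Fin M) : TrainingSpace M β :=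
  channelCoeff β k m - estimateCoeff β x p k m

theorem inner_channelCoeff_channelCoeff (k m k' m' : Fin M) :
    inner ℂ (channelCoeff β k m) (channelCoeff β k' m') = if (k, m) = (k', m') then 1 else 0 := by
  simp [channelCoeff, EuclideanSpace.inner_single_left]

theorem inner_channelCoeff_receivedCoeff (x : Fin M → ℕ → ℂ) (k m k' : Fin M) (t : Fin β)
    (m' : Fin M) : inner ℂ (channelCoeff β k m) (receivedCoeff x k' t m')
      = if (k, m) = (k', m') then x k t else 0 := by
  rw [receivedCoeff, inner_add_right, inner_smul_right, inner_channelCoeff_channelCoeff]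
  have : inner ℂ (channelCoeff β k m) (EuclideanSpace.single (Sum.inr (k', t, m')) (1 : ℂ)) = 0 := by
    simp [channelCoeff, EuclideanSpace.inner_single_left]
  rw [this]
  split_ifs with h
  · obtain ⟨rfl, rfl⟩ := Prod.mk.inj h; simp
  · simp

theorem inner_receivedCoeff_receivedCoeff (x : Fin M → ℕ → ℂ) (k k' : Fin M) (t t' : Fin β)
    (m m' : Fin M) : inner ℂ (receivedCoeff x k t m) (receivedCoeff x k' t' m')
      = if (k, m) = (k', m') then starRingEnd ℂ (x k t) * x k t' + (if t = t' then 1 else 0)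
        else 0 := by
  rw [receivedCoeff, inner_add_left, inner_smul_left, inner_channelCoeff_receivedCoeff]
  have : inner ℂ (EuclideanSpace.single (Sum.inr (k, t, m)) (1 : ℂ)) (receivedCoeff x k' t' m')
      = if (k, t, m) = (k', t', m') then 1 else 0 := by
    simp [receivedCoeff, channelCoeff, EuclideanSpace.inner_single_left]
  rw [this]
  simp only [Prod.mk.injEq]
  split_ifs <;> simp_all

theorem inner_channelCoeff_estimateCoeff {x : Fin M → ℕ → ℂ} {p : ℝ}
    (hx : ∀ k t, ‖x k t‖ ^ 2 = p) (k m k' m' : Fin M) :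
    inner ℂ (channelCoeff β k m) (estimateCoeff β x p k' m')
      = if (k, m) = (k', m') then ((β * p / (1 + β * p) : ℝ) : ℂ) else 0 := by
  simp only [estimateCoeff, inner_sum, inner_smul_right, inner_channelCoeff_receivedCoeff]
  split_ifs with h
  · obtain ⟨rfl, rfl⟩ := Prod.mk.inj h
    have : ∀ t : Fin β, starRingEnd ℂ (x k t) / ((1 + β * p : ℝ) : ℂ) * x k t
        = ((p / (1 + β * p) : ℝ) : ℂ) := fun t => by
      rw [div_mul_eq_mul_div, Complex.conj_mul', ← hx k t]
      push_cast
      rfl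
    simp only [this, Finset.sum_const, Finset.card_univ, Fintype.card_fin, nsmul_eq_mul]
    push_cast
    ring
  · simp

/-- These are the normal equations of linear estimation. The overlap of the estimate with pilot `t`
is `x k t` times (βp + 1)/(1 + βp), from the channel and the noise; the factor 1/(1 + βp) in the
estimate makes it equal to that of the channel. -/
theorem inner_errorCoeff_receivedCoeff {x : Fin M → ℕ → ℂ} {p : ℝ} (hp : 0 < p)
    (hx : ∀ k t, ‖x k t‖ ^ 2 = p) (k m k' : Fin M) (t : Fin β) (m' : Fin M) :
    inner ℂ (errorCoeff β x p k m) (receivedCoeff x k' t m') = 0 := by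
  have hn : ((1 + β * p : ℝ) : ℂ) ≠ 0 := by
    have : (0 : ℝ) < 1 + β * p := by positivity
    exact_mod_cast this.ne'
  simp only [errorCoeff, estimateCoeff, inner_sub_left, sum_inner, inner_smul_left,
    inner_channelCoeff_receivedCoeff, inner_receivedCoeff_receivedCoeff]
  split_ifs with h
  · have : ∀ s : Fin β, starRingEnd ℂ (starRingEnd ℂ (x k s) / ((1 + β * p : ℝ) : ℂ))
        * (starRingEnd ℂ (x k s) * x k t + if s = t then 1 else 0)
        = (p : ℂ) * x k t / ((1 + β * p : ℝ) : ℂ)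
          + if s = t then x k t / ((1 + β * p : ℝ) : ℂ) else 0 := fun s => by
      rw [map_div₀, Complex.conj_conj, Complex.conj_ofReal, mul_add, ← hx k s]
      congr 1
      · rw [Complex.ofReal_pow, ← Complex.mul_conj']
        ring
      · split_ifs with hs
        · rw [hs, mul_one]
        · simp
    rw [Finset.sum_congr rfl fun s _ => this s, Finset.sum_add_distrib, Finset.sum_const,
      Finset.sum_ite_eq' Finset.univ t, if_pos (Finset.mem_univ t), Finset.card_univ,
      Fintype.card_fin, nsmul_eq_mul]
    field_simp
    push_cast
    ring
  · simp

theorem inner_errorCoeff_estimateCoeff {x : Fin M → ℕ → ℂ} {p : ℝ} (hp : 0 < p)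
    (hx : ∀ k t, ‖x k t‖ ^ 2 = p) (k m k' m' : Fin M) :
    inner ℂ (errorCoeff β x p k m) (estimateCoeff β x p k' m') = 0 := by
  conv_lhs => rw [estimateCoeff]
  simp [inner_errorCoeff_receivedCoeff hp hx]

/-- The error is orthogonal to the estimate, so its variance is its overlap with the channel, 1 -
βp/(1 + βp). -/
theorem inner_errorCoeff_errorCoeff {x : Fin M → ℕ → ℂ} {p : ℝ} (hp : 0 < p)
    (hx : ∀ k t, ‖x k t‖ ^ 2 = p) (k m k' m' : Fin M) :
    inner ℂ (errorCoeff β x p k m) (errorCoeff β x p k' m')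
      = if (k, m) = (k', m') then ((1 / (1 + β * p) : ℝ) : ℂ) else 0 := by
  have hn : (1 + β * p : ℝ) ≠ 0 := by positivity
  have h1 : inner ℂ (errorCoeff β x p k m) (errorCoeff β x p k' m')
      = inner ℂ (errorCoeff β x p k m) (channelCoeff β k' m') := by
    conv_lhs => rw [errorCoeff.eq_def β x p k' m', inner_sub_right,
      inner_errorCoeff_estimateCoeff hp hx, sub_zero]
  rw [h1, errorCoeff, inner_sub_left, inner_channelCoeff_channelCoeff,
    ← inner_conj_symm, inner_channelCoeff_estimateCoeff hx]
  simp only [eq_comm (a := (k', m'))]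
  split_ifs
  · rw [Complex.conj_ofReal, ← Complex.ofReal_one, ← Complex.ofReal_sub]
    congr 1
    field_simp
    ring
  · simp

theorem inner_estimateCoeff_estimateCoeff_of_ne (x : Fin M → ℕ → ℂ) (p : ℝ) {k m k' m' : Fin M}
    (hne : (k, m) ≠ (k', m')) :
    inner ℂ (estimateCoeff β x p k m) (estimateCoeff β x p k' m') = 0 := by
  simp [estimateCoeff,
    inner_receivedCoeff_receivedCoeff, hne]

/-- Its overlap βp/(1 + βp) with the channel is positive; with no pilots the estimate would vanish
and zero-forcing would degenerate. -/
theorem estimateCoeff_ne_zero (hβ : 1 ≤ β) {x : Fin M → ℕ → ℂ} {p : ℝ} (hp : 0 < p)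
    (hx : ∀ k t, ‖x k t‖ ^ 2 = p) (k m : Fin M) : estimateCoeff β x p k m ≠ 0 := fun h => by
  have h1 := inner_channelCoeff_estimateCoeff (β := β) hx k m k m
  have hb : (0 : ℝ) < β := by exact_mod_cast hβ
  have : (β * p / (1 + β * p) : ℝ) ≠ 0 := by positivity
  rw [h, inner_zero_right, if_pos rfl] at h1
  exact this (by exact_mod_cast h1.symm)

variable {Ω : Type*} {h : Fin M → Fin M → Ω → ℂ} {z : Fin M → ℕ → Fin M → Ω → ℂ}

theorem linearCombinations_channelCoeff (k m : Fin M) :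
    linearCombinations (trainingVariables h z β) (channelCoeff β k m) = h k m :=
  linearCombinations_single _ _

theorem linearCombinations_receivedCoeff (x : Fin M → ℕ → ℂ) (k : Fin M) (t : Fin β) (m : Fin M) :
    linearCombinations (trainingVariables h z β) (receivedCoeff x k t m)
      = receivedPilot h z x k t m := by
  rw [receivedCoeff, map_add, map_smul, linearCombinations_channelCoeff, linearCombinations_single]
  ext ω
  simp [receivedPilot, trainingVariables, mul_comm]

/-- The channel is estimate plus error. The estimate is a function of the received pilots; the error
is orthogonal to all of them, hence independent of the training σ-algebra, and has mean zero. -/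
theorem mmseEstimate_ae_eq [MeasurableSpace Ω] {μ : Measure Ω} [IsProbabilityMeasure μ]
    (hmodel : IsRayleighTraining μ h z) {x : Fin M → ℕ → ℂ} {p : ℝ} (hp : 0 < p)
    (hx : ∀ k t, ‖x k t‖ ^ 2 = p) (β : ℕ) :
    ∀ᵐ ω ∂μ, mmseEstimate μ h z x β ω = Matrix.of fun k m =>
      linearCombinations (trainingVariables h z β) (estimateCoeff β x p k m) ω := by
  set ξ := linearCombinations (trainingVariables h z β) with hξdef
  have hξ : IsComplexIsonormal μ ξ := hmodel.isComplexIsonormal β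
  have hYm : Measurable fun (ω : Ω) (k : Fin M) (t : Fin β) (m : Fin M) =>
      receivedPilot h z x k t m ω :=
    measurable_pi_lambda _ fun k => measurable_pi_lambda _ fun t => measurable_pi_lambda _ fun m =>
      by rw [← linearCombinations_receivedCoeff]; exact hξ.measurable _
  have hle : trainingSigma h z x β ≤ ‹MeasurableSpace Ω› := hYm.comap_le
  have key : ∀ k m, μ[h k m | trainingSigma h z x β] =ᵐ[μ] ξ (estimateCoeff β x p k m) := by
    intro k m
    have hsplit : h k m = ξ (estimateCoeff β x p k m) + ξ (errorCoeff β x p k m) := by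
      rw [← map_add, errorCoeff, add_sub_cancel, linearCombinations_channelCoeff]
    have hest : StronglyMeasurable[trainingSigma h z x β] (ξ (estimateCoeff β x p k m)) := by
      have hg : Measurable fun y : Fin M → Fin β → Fin M → ℂ =>
          ∑ t : Fin β, (starRingEnd ℂ (x k t) / (1 + β * p : ℝ)) * y k t m := by fun_prop
      have heq : ξ (estimateCoeff β x p k m)
          = (fun y : Fin M → Fin β → Fin M → ℂ =>
            ∑ t : Fin β, (starRingEnd ℂ (x k t) / (1 + β * p : ℝ)) * y k t m)
            ∘ fun (ω : Ω) (k : Fin M) (t : Fin β) (m : Fin M) => receivedPilot h z x k t m ω := by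
        ext ω
        simp [hξdef, estimateCoeff, linearCombinations_receivedCoeff]
      rw [heq]
      exact (hg.comp (comap_measurable _)).stronglyMeasurable
    have hind : IndepFun (ξ (errorCoeff β x p k m))
        (fun (ω : Ω) (k : Fin M) (t : Fin β) (m : Fin M) => receivedPilot h z x k t m ω) μ := by
      have h1 := hξ.indepFun (fun _ : Unit => errorCoeff β x p k m)
        (fun q : Fin M × Fin β × Fin M => receivedCoeff x q.1 q.2.1 q.2.2)
        (fun _ q => inner_errorCoeff_receivedCoeff hp hx _ _ _ _ _)
      have h2 : Measurable fun (y : Fin M × Fin β × Fin M → ℂ) (k : Fin M) (t : Fin β)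
          (m : Fin M) => y (k, t, m) := by fun_prop
      convert! h1.comp (measurable_pi_apply ()) h2 using 1
      ext ω k t m
      simp [hξdef, linearCombinations_receivedCoeff]
    have herr : μ[ξ (errorCoeff β x p k m) | trainingSigma h z x β] =ᵐ[μ] fun _ => 0 := by
      have h1 := condExp_indep_eq (hξ.measurable (errorCoeff β x p k m)).comap_le hle
        (comap_measurable _).stronglyMeasurable hind
      rwa [hξ.integral_eq_zero] at h1
    rw [hsplit]
    refine (condExp_add (hξ.integrable _) (hξ.integrable _) _).trans ?_
    rw [condExp_of_stronglyMeasurable hle hest (hξ.integrable _)]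
    filter_upwards [herr] with ω hω
    simp [hω]
  have hall : ∀ᵐ ω ∂μ, ∀ k m, (μ[h k m | trainingSigma h z x β]) ω
      = ξ (estimateCoeff β x p k m) ω := by
    rw [ae_all_iff]; intro k
    rw [ae_all_iff]; intro m
    exact key k m
  filter_upwards [hall] with ω hω
  ext k m
  exact hω k m

end

/-! ### The pointwise rate inequality and integrability. -/

/-- Linearisation, at signal power `s` and total disturbance `A`, of the rate with interference
`I + c` below the rate without interference. -/
theorem log_one_add_div_ge {S I c s A : ℝ} (hS : 0 ≤ S) (hI : 0 ≤ I) (hc : 0 < c) (hs : 0 < s)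
    (hA : 0 < A) :
    Real.log (1 + S) + (Real.log (1 + c / (1 + s)) + c / ((1 + s) * (1 + c + s)) * (s - S))
      - (Real.log A + ((1 + I + c) / A - 1)) ≤ Real.log (1 + S / (1 + I + c)) := by
  have h1 : Real.log (1 + S / (1 + I + c)) = Real.log (1 + I + c + S) - Real.log (1 + I + c) := by
    rw [← Real.log_div (by positivity) (by positivity)]
    congr 1
    field_simp
  have h2 : Real.log (1 + c + S) ≤ Real.log (1 + I + c + S) :=
    Real.log_le_log (by positivity) (by linarith)
  -- Tangent line of the concave logarithm at `A`.
  have h3 : Real.log (1 + I + c) ≤ Real.log A + ((1 + I + c) / A - 1) := by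
    have := Real.log_le_sub_one_of_pos (show 0 < (1 + I + c) / A by positivity)
    rw [Real.log_div (by positivity) hA.ne'] at this
    linarith
  have h4 : Real.log (1 + c / (1 + s)) = Real.log (1 + c + s) - Real.log (1 + s) := by
    rw [← Real.log_div (by positivity) (by positivity)]
    congr 1
    field_simp
    ring
  -- The bound 1 - 1/y ≤ log y, at the ratio of 1 + c/(1+S) to 1 + c/(1+s).
  have h5 : c * (s - S) / ((1 + s) * (1 + c + S))
      ≤ Real.log (1 + s) + Real.log (1 + c + S) - (Real.log (1 + S) + Real.log (1 + c + s)) := by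
    have := Real.one_sub_inv_le_log_of_pos
      (show 0 < (1 + s) * (1 + c + S) / ((1 + S) * (1 + c + s)) by positivity)
    rw [Real.log_div (by positivity) (by positivity), Real.log_mul (by positivity) (by positivity),
      Real.log_mul (by positivity) (by positivity), inv_div] at this
    refine le_trans (le_of_eq ?_) this
    field_simp
    ring
  -- Replacing `S` by `s` in the slope costs a nonnegative multiple of (s - S)². With `h5` this is
  -- the tangent line at `s` of the convex function S ↦ log(1 + c/(1+S)).
  have h6 : c / ((1 + s) * (1 + c + s)) * (s - S) ≤ c * (s - S) / ((1 + s) * (1 + c + S)) := by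
    rw [← sub_nonneg]
    have : c * (s - S) / ((1 + s) * (1 + c + S)) - c / ((1 + s) * (1 + c + s)) * (s - S)
        = c * (s - S) ^ 2 / ((1 + s) * (1 + c + S) * (1 + c + s)) := by
      field_simp
      ring
    rw [this]
    positivity
  linarith

theorem integrable_norm_sq_of_map_eq {Ω : Type*} [MeasurableSpace Ω] {μ : Measure Ω} {Z : Ω → ℂ}
    (hZ : Measurable Z) (hlaw : μ.map Z = stdComplexGaussian) :
    Integrable (fun ω => ‖Z ω‖ ^ 2) μ := by
  have h := integrable_norm_sq_stdComplexGaussian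
  rw [← hlaw] at h
  exact h.comp_measurable hZ

theorem integral_comp_of_map_eq {Ω : Type*} [MeasurableSpace Ω] {μ : Measure Ω} {Z : Ω → ℂ}
    (hZ : Measurable Z) (hlaw : μ.map Z = stdComplexGaussian) {φ : ℂ → ℝ} (hφ : Measurable φ) :
    ∫ ω, φ (Z ω) ∂μ = ∫ x, φ x ∂stdComplexGaussian := by
  rw [← hlaw, integral_map hZ.aemeasurable hφ.aestronglyMeasurable]

theorem integrable_log_one_add {Ω : Type*} [MeasurableSpace Ω] {μ : Measure Ω} {S : Ω → ℝ}
    (hS : Integrable S μ) (h0 : ∀ ω, 0 ≤ S ω) : Integrable (fun ω => Real.log (1 + S ω)) μ := by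
  refine hS.mono' (Real.measurable_log.comp_aemeasurable
    (hS.aemeasurable.const_add 1)).aestronglyMeasurable (ae_of_all _ fun ω => ?_)
  have h1 := h0 ω
  rw [Real.norm_of_nonneg (Real.log_nonneg (by linarith))]
  have := Real.log_le_sub_one_of_pos (show 0 < 1 + S ω by linarith)
  linarith

/-! ### Laws of the beam powers. -/

section

variable {Ω : Type*} [MeasurableSpace Ω] {μ : Measure Ω} [IsProbabilityMeasure μ] {M : ℕ}
  {h : Fin M → Fin M → Ω → ℂ} {z : Fin M → ℕ → Fin M → Ω → ℂ}

theorem orthonormal_channelCoeff {M : ℕ} (β : ℕ) (k : Fin M) :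
    Orthonormal ℂ (channelCoeff β k) := by
  rw [orthonormal_iff_ite]
  intro i j
  rw [inner_channelCoeff_channelCoeff]
  simp

theorem orthonormal_smul_errorCoeff {M : ℕ} (β : ℕ) {x : Fin M → ℕ → ℂ} {p : ℝ} (hp : 0 < p)
    (hx : ∀ k t, ‖x k t‖ ^ 2 = p) (k : Fin M) :
    Orthonormal ℂ fun m => ((Real.sqrt (1 + β * p) : ℝ) : ℂ) • errorCoeff β x p k m := by
  have hn : (0 : ℝ) < 1 + β * p := by positivity
  rw [orthonormal_iff_ite]
  intro i j
  rw [inner_smul_left, inner_smul_right, inner_errorCoeff_errorCoeff hp hx, Complex.conj_ofReal,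
    ← mul_assoc, ← Complex.ofReal_mul, Real.mul_self_sqrt hn.le]
  simp only [Prod.mk.injEq, true_and]
  split_ifs
  · rw [← Complex.ofReal_mul, mul_one_div_cancel hn.ne', Complex.ofReal_one]
  · simp

/-- With perfect channel knowledge there is no interference and the signal power is that of a
standard complex Gaussian coefficient. -/
theorem exists_instantRate_channelMatrix_ae_eq (hmodel : IsRayleighTraining μ h z) (P : ℝ)
    (k : Fin M) : ∃ Z : Ω → ℂ, Measurable Z ∧ μ.map Z = stdComplexGaussian ∧
      ∀ᵐ ω ∂μ, instantRate P 0 (channelMatrix h ω) (channelMatrix h ω) k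
        = Real.log (1 + P / M * ‖Z ω‖ ^ 2) := by
  -- Perfect knowledge involves no pilots, so the family with β = 0 suffices.
  have hξ := hmodel.isComplexIsonormal 0
  have hdet := hξ.ae_det_ne_zero (channelCoeff 0)
    (fun i j h0 => by
      have := inner_channelCoeff_channelCoeff (β := 0) i j i j
      simp [h0] at this)
    (fun i j i' j' hne => by rw [inner_channelCoeff_channelCoeff, if_neg hne])
  obtain ⟨Z, hZ, hlaw, hZeq⟩ := hξ.exists_map_eq_norm_zfVector (orthonormal_channelCoeff 0 k)
    (channelCoeff 0) (fun m i j hi => by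
      rw [inner_channelCoeff_channelCoeff, if_neg (fun e => hi (Prod.mk.inj e).1.symm)]) hdet
  refine ⟨Z, hZ, hlaw, ?_⟩
  filter_upwards [hdet, hZeq] with ω hω hZω
  simp only [linearCombinations_channelCoeff] at hω hZω
  change (channelMatrix h ω).det ≠ 0 at hω
  change ‖∑ m, channelMatrix h ω k m * zfVector (channelMatrix h ω) k m‖ = _ at hZω
  have hibi : ibiPower P (channelMatrix h ω) (channelMatrix h ω) k = 0 :=
    Finset.sum_eq_zero fun j hj => by
      rw [beamPower, sum_mul_zfVector_of_ne hω (Finset.ne_of_mem_erase hj)]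
      simp
  rw [instantRate, hibi, beamPower, hZω]
  simp

/-- With zero-forcing on the MMSE estimate, the power of each beam at user `k` is that of a complex
Gaussian coefficient, whose variance is the error variance for the beams of the other users. -/
theorem exists_beamPower_mmseEstimate_ae_eq (hmodel : IsRayleighTraining μ h z)
    {x : Fin M → ℕ → ℂ} {p : ℝ} (hp : 0 < p) (hx : ∀ k t, ‖x k t‖ ^ 2 = p) {β : ℕ} (hβ : 1 ≤ β)
    (P : ℝ) (k j : Fin M) : ∃ Z : Ω → ℂ, Measurable Z ∧ μ.map Z = stdComplexGaussian ∧
      ∀ᵐ ω ∂μ, beamPower P (channelMatrix h ω) (mmseEstimate μ h z x β ω) k j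
        = P / M * (if j = k then 1 else 1 / (1 + β * p)) * ‖Z ω‖ ^ 2 := by
  have hξ := hmodel.isComplexIsonormal β
  have hdet := hξ.ae_det_ne_zero (estimateCoeff β x p) (estimateCoeff_ne_zero hβ hp hx)
    (fun _ _ _ _ => inner_estimateCoeff_estimateCoeff_of_ne x p)
  have hmmse := mmseEstimate_ae_eq hmodel hp hx β
  set ξ := linearCombinations (trainingVariables h z β) with hξdef
  have hch : ∀ k m, ξ (channelCoeff β k m) = h k m := linearCombinations_channelCoeff
  by_cases hjk : j = k
  · subst hjk
    obtain ⟨Z, hZ, hlaw, hZeq⟩ := hξ.exists_map_eq_norm_zfVector (orthonormal_channelCoeff β j)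
      (estimateCoeff β x p) (fun m i l hi => by
        rw [inner_channelCoeff_estimateCoeff hx, if_neg (fun e => hi (Prod.mk.inj e).1.symm)]) hdet
    refine ⟨Z, hZ, hlaw, ?_⟩
    filter_upwards [hmmse, hZeq] with ω hω hZω
    simp only [hch] at hZω
    rw [hω, if_pos rfl, mul_one, ← hZω]
    rfl
  · have hn : (0 : ℝ) < 1 + β * p := by positivity
    have hF : Measurable fun y : Fin M × Fin M → ℂ =>
        zfVector (Matrix.of fun i l => y (i, l)) j :=
      measurable_zfVector (fun i l => measurable_pi_apply (i, l)) j
    have hunit : ∀ᵐ ω ∂μ, ∑ m, ‖zfVector (Matrix.of fun i l =>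
        ξ (estimateCoeff β x p i l) ω) j m‖ ^ 2 = 1 := by
      filter_upwards [hdet] with ω hω
      exact sum_norm_sq_zfVector hω j
    have hlaw := hξ.map_sum_mul_eq_of_orthogonal (orthonormal_smul_errorCoeff β hp hx k)
      (c := fun q : Fin M × Fin M => estimateCoeff β x p q.1 q.2)
      (fun m q => by
        rw [inner_smul_left, inner_errorCoeff_estimateCoeff hp hx, mul_zero]) hF hunit
    have hmeas : Measurable fun ω (q : Fin M × Fin M) => ξ (estimateCoeff β x p q.1 q.2) ω :=
      measurable_pi_lambda _ fun _ => hξ.measurable _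
    -- The factor √(1 + βp) normalises the error row to unit variance; its square reappears as the
    -- leakage variance.
    refine ⟨fun ω => ∑ m, ξ (((Real.sqrt (1 + β * p) : ℝ) : ℂ) • errorCoeff β x p k m) ω
        * zfVector (Matrix.of fun i l => ξ (estimateCoeff β x p i l) ω) j m,
      Finset.measurable_fun_sum _ fun m _ => (hξ.measurable _).mul ((measurable_pi_apply m).comp (hF.comp hmeas)), hlaw, ?_⟩
    filter_upwards [hmmse, hdet] with ω hω hdω
    have hzero := sum_mul_zfVector_of_ne hdω hjk
    simp only [Matrix.of_apply] at hzero
    have hsum : ∑ m, channelMatrix h ω k m * zfVector (mmseEstimate μ h z x β ω) j m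
        = ∑ m, ξ (errorCoeff β x p k m) ω
          * zfVector (Matrix.of fun i l => ξ (estimateCoeff β x p i l) ω) j m := by
      -- The difference of the two sums is the estimated row of user `k` on beam `j`, which
      -- zero-forcing annihilates.
      rw [hω, ← sub_eq_zero, ← hzero, ← Finset.sum_sub_distrib]
      refine Finset.sum_congr rfl fun m _ => ?_
      rw [errorCoeff, map_sub, hch, Pi.sub_apply, channelMatrix, Matrix.of_apply]
      ring
    rw [beamPower, hsum, if_neg hjk]
    simp only [map_smul, Pi.smul_apply, smul_eq_mul, mul_assoc, ← Finset.mul_sum, norm_mul,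
      Complex.norm_real, mul_pow, Real.norm_eq_abs, sq_abs, Real.sq_sqrt hn.le]
    field_simp

end

/-! ### Integration of the pointwise bound, and the limit. -/

theorem theorem1 {Ω : Type*} [MeasurableSpace Ω] (μ : Measure Ω) [IsProbabilityMeasure μ]
    (M : ℕ) (h : Fin M → Fin M → Ω → ℂ) (z : Fin M → ℕ → Fin M → Ω → ℂ)
    (hmodel : IsRayleighTraining μ h z)
    (P f α : ℝ) (hP : 0 < P) (hf : 0 < f) (hf1 : f ≤ 1) (hα : 0 < α)
    (xUP : Fin M → ℕ → ℂ) (hxUP : ∀ k t, ‖xUP k t‖ ^ 2 = f * P)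
    (k : Fin M) :
    Integrable
      (fun ω => instantRate P 0 (channelMatrix h ω) (channelMatrix h ω) k) μ ∧
    (∀ β : ℕ, 1 ≤ β →
      Integrable (fun ω => instantRate P (α * f * P) (channelMatrix h ω)
        (mmseEstimate μ h z xUP β ω) k) μ ∧
      rateINI μ h z xUP P f α β k ≥ rateZF μ h P k -
        Real.log ((1 + P / M * ((M - 1) / (1 + β * f * P)) + α * f * P) /
          (1 + α * f * P / (1 + P / M)))) ∧
    Tendsto
      (fun β : ℕ => Real.log ((1 + P / M * ((M - 1) / (1 + β * f * P)) + α * f * P) /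
        (1 + α * f * P / (1 + P / M)))) atTop
      (𝓝 (Real.log ((1 + α * f * P) / (1 + α * f * P / (1 + P / M))))) := by
  have hM : 0 < M := Fin.pos k
  have hM1 : (1 : ℝ) ≤ M := by exact_mod_cast hM
  have hs : 0 < P / M := by positivity
  have hp : 0 < f * P := by positivity
  have hc : 0 < α * f * P := by positivity
  obtain ⟨Z₀, hZ₀, hlaw₀, hrate₀⟩ := exists_instantRate_channelMatrix_ae_eq hmodel P k
  have hint₀ := integrable_log_one_add ((integrable_norm_sq_of_map_eq hZ₀ hlaw₀).const_mul (P / M))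
    (fun ω => by positivity)
  refine ⟨hint₀.congr (hrate₀.mono fun ω hω => hω.symm), fun β hβ => ?_, ?_⟩
  · choose Z hZ hlaw hbeam using exists_beamPower_mmseEstimate_ae_eq hmodel hp hxUP hβ P k
    set c := α * f * P
    set s := P / M
    set v : ℝ := 1 / (1 + β * (f * P)) with hv
    have hv0 : 0 ≤ v := by positivity
    let S : Ω → ℝ := fun ω => s * ‖Z k ω‖ ^ 2
    let I : Ω → ℝ := fun ω => ∑ j ∈ Finset.univ.erase k, s * v * ‖Z j ω‖ ^ 2
    have hS0 : ∀ ω, 0 ≤ S ω := fun ω => by positivity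
    have hI0 : ∀ ω, 0 ≤ I ω := fun ω => Finset.sum_nonneg fun j _ => by positivity
    have hSint : Integrable S μ := (integrable_norm_sq_of_map_eq (hZ k) (hlaw k)).const_mul s
    have hIterm : ∀ j, Integrable (fun ω => s * v * ‖Z j ω‖ ^ 2) μ := fun j =>
      (integrable_norm_sq_of_map_eq (hZ j) (hlaw j)).const_mul _
    have hIint : Integrable I μ := integrable_finsetSum _ fun j _ => hIterm j
    have hnorm : ∀ j, ∫ ω, ‖Z j ω‖ ^ 2 ∂μ = 1 := fun j => by
      rw [integral_comp_of_map_eq (hZ j) (hlaw j) (φ := fun x => ‖x‖ ^ 2) (by fun_prop),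
        integral_norm_sq_stdComplexGaussian]
    have hSval : ∫ ω, S ω ∂μ = s := by
      simp only [S, integral_const_mul, hnorm, mul_one]
    have hIval : ∫ ω, I ω ∂μ = s * ((M - 1) / (1 + β * f * P)) := by
      simp only [I]
      rw [integral_finsetSum _ fun j _ => hIterm j]
      simp only [integral_const_mul, hnorm, mul_one, Finset.sum_const,
        Finset.card_erase_of_mem (Finset.mem_univ k), Finset.card_univ, Fintype.card_fin,
        nsmul_eq_mul, Nat.cast_pred hM, hv, mul_assoc]
      ring
    have hrate : ∀ᵐ ω ∂μ, instantRate P c (channelMatrix h ω) (mmseEstimate μ h z xUP β ω) k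
        = Real.log (1 + S ω / (1 + I ω + c)) := by
      filter_upwards [ae_all_iff.2 hbeam] with ω hω
      rw [instantRate, ibiPower, hω k, if_pos rfl, mul_one]
      congr 4
      refine congr_arg (1 + ·) (Finset.sum_congr rfl fun j hj => ?_)
      rw [hω j, if_neg (Finset.ne_of_mem_erase hj)]
    have hdiv : Integrable (fun ω => S ω / (1 + I ω + c)) μ := by
      refine hSint.mono' (hSint.aemeasurable.div
        ((hIint.aemeasurable.const_add 1).add_const c)).aestronglyMeasurable
        (ae_of_all _ fun ω => ?_)
      have h1 := hS0 ω
      have h2 := hI0 ω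
      rw [Real.norm_of_nonneg (by positivity)]
      exact div_le_self h1 (by linarith)
    have hint := integrable_log_one_add hdiv fun ω => by
      have h1 := hS0 ω
      have h2 := hI0 ω
      positivity
    refine ⟨hint.congr (hrate.mono fun ω hω => hω.symm), ?_⟩
    set A := 1 + s * ((M - 1) / (1 + β * f * P)) + c with hAdef
    have hA : 0 < A := by
      have : (0 : ℝ) ≤ M - 1 := by linarith
      positivity
    have hlogS := integrable_log_one_add hSint hS0
    -- `Z₀` and `Z k` are different variables; only their common law is used.
    have hZF : rateZF μ h P k = ∫ ω, Real.log (1 + S ω) ∂μ := by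
      rw [rateZF, integral_congr_ae hrate₀,
        integral_comp_of_map_eq hZ₀ hlaw₀ (φ := fun x => Real.log (1 + s * ‖x‖ ^ 2)) (by fun_prop),
        integral_comp_of_map_eq (hZ k) (hlaw k) (φ := fun x => Real.log (1 + s * ‖x‖ ^ 2))
          (by fun_prop)]
    have hlin₁ : Integrable (fun ω => Real.log (1 + c / (1 + s))
        + c / ((1 + s) * (1 + c + s)) * (s - S ω)) μ :=
      (integrable_const _).add (((integrable_const _).sub hSint).const_mul _)
    have hlin₂ : Integrable (fun ω => Real.log A + ((1 + I ω + c) / A - 1)) μ :=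
      (integrable_const _).add (((((integrable_const _).add hIint).add
        (integrable_const _)).div_const _).sub (integrable_const _))
    -- On integration both linear corrections vanish, since `s` is the mean of `S` and `A` that of 1
    -- + I + c.
    have hle := integral_mono ((hlogS.add hlin₁).sub hlin₂) hint fun ω =>
      log_one_add_div_ge (hS0 ω) (hI0 ω) hc hs hA
    have hval₁ : ∫ ω, (Real.log (1 + c / (1 + s))
        + c / ((1 + s) * (1 + c + s)) * (s - S ω)) ∂μ = Real.log (1 + c / (1 + s)) := by
      have h1 : Integrable (fun ω => s - S ω) μ := (integrable_const _).sub hSint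
      rw [integral_add (integrable_const _) (h1.const_mul _), integral_const_mul, integral_sub (integrable_const _) hSint, hSval]
      simp
    have hval₂ : ∫ ω, (Real.log A + ((1 + I ω + c) / A - 1)) ∂μ = Real.log A := by
      have h1 : Integrable (fun ω => 1 + I ω) μ := (integrable_const _).add hIint
      have h2 : Integrable (fun ω => 1 + I ω + c) μ := h1.add (integrable_const _)
      have h3 : Integrable (fun ω => (1 + I ω + c) / A - 1) μ :=
        (h2.div_const _).sub (integrable_const _)
      rw [integral_add (integrable_const _) h3,
        integral_sub (h2.div_const _) (integrable_const _), integral_div,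
        integral_add h1 (integrable_const _), integral_add (integrable_const _) hIint, hIval]
      simp only [integral_const, probReal_univ, one_smul]
      rw [← hAdef, div_self hA.ne', sub_self, add_zero]
    rw [integral_sub' (hlogS.add hlin₁) hlin₂, integral_add' hlogS hlin₁, hval₁, hval₂] at hle
    rw [rateINI, integral_congr_ae hrate, hZF,
      Real.log_div hA.ne' (by positivity)]
    linarith
  · have h1 : Tendsto (fun β : ℕ => 1 + (β : ℝ) * f * P) atTop atTop := by
      simp only [mul_assoc]
      exact tendsto_atTop_add_const_left _ _
        (tendsto_natCast_atTop_atTop.atTop_mul_const hp)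
    have h2 : Tendsto (fun β : ℕ => 1 + P / M * (((M : ℝ) - 1) / (1 + β * f * P)) + α * f * P)
        atTop (𝓝 (1 + P / M * 0 + α * f * P)) :=
      (((h1.const_div_atTop _).const_mul _).const_add _).add_const _
    rw [mul_zero, add_zero] at h2
    exact (h2.div_const _).log (by positivity)
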